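/- **Definition.** Let $X$ be a Banach space and let $M_X$ be the family of all nonempty bounded subsets of $X$. A mapping $\mu : M_X \to [0,\infty)$ is called a measure of noncompactness if, for all $A, B \in M_X$: - ($M_1$) the kernel $\{A \in M_X : \mu(A) = 0\}$ is nonempty and all its members are relatively compact; - ($M_2$) $A \subseteq B$ implies $\mu(A) \le \mu(B)$; - ($M_3$) $\mu(\overline{A}) = \mu(A)$; - ($M_4$) $\mu(\operatorname{conv} A) = \mu(A)$, where $\operatorname{conv} A$ is the convex hull of $A$; - ($M_5$) $\mu(\lambda A + (1-\lambda) B) \le \lambda \mu(A) + (1-\lambda)\mu(B)$ for all $\lambda \in [0,1]$; - ($M_6$) if $(A_n)$ is a sequence of closed sets in $M_X$ with $A_{n+1} \subseteq A_n$ for all $n$ and $\lim_{n\to\infty} \mu(A_n) = 0$, then $\bigcap_n A_n$ is nonempty. **Corollary 3.7 (Darbo's theorem recovered).** Let $E$ be a nonempty, bounded, closed and convex subset of a Banach space $X$, let $\mu$ be an arbitrary measure of noncompactness on $X$, and let $T : E \to E$ be a continuous mapping. Suppose that there exists a constant $k \in [0,1)$ such that $$\mu(TA) \le k\,\mu(A)$$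 for every nonempty subset $A \subseteq E$. Then $T$ has a fixed point in $E$. -/

import Mathlib

open Filter Topology
open scoped Pointwise

/-- The family of all nonempty bounded subsets of `X`. -/
def nonemptyBounded (X : Type*) [NormedAddCommGroup X] : Set (Set X) :=
  {A | A.Nonempty ∧ Bornology.IsBounded A}

/-- `μ` is a measure of noncompactness on the normed space `X`, in the axiomatic sense.
The mapping is really defined on the nonempty bounded subsets only: every axiom concerns such
sets alone, and the values of `μ` at other sets are irrelevant. -/
structure IsMeasureOfNoncompactness {X : Type*} [NormedAddCommGroup X] [NormedSpace ℝ X]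
    (μ : Set X → ℝ) : Prop where
  nonneg : ∀ A ∈ nonemptyBounded X, 0 ≤ μ A
  /-- The kernel of `μ` is nonempty. -/
  ker_nonempty : ∃ A ∈ nonemptyBounded X, μ A = 0
  /-- The kernel of `μ` consists of relatively compact sets. -/
  isCompact_closure_of_eq_zero : ∀ A ∈ nonemptyBounded X, μ A = 0 → IsCompact (closure A)
  mono : ∀ A ∈ nonemptyBounded X, ∀ B ∈ nonemptyBounded X, A ⊆ B → μ A ≤ μ B
  closure_eq : ∀ A ∈ nonemptyBounded X, μ (closure A) = μ A
  convexHull_eq : ∀ A ∈ nonemptyBounded X, μ (convexHull ℝ A) = μ A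
  convex_comb_le : ∀ A ∈ nonemptyBounded X, ∀ B ∈ nonemptyBounded X, ∀ t ∈ Set.Icc (0 : ℝ) 1,
    μ (t • A + (1 - t) • B) ≤ t * μ A + (1 - t) * μ B
  iInter_nonempty : ∀ A : ℕ → Set X, (∀ n, A n ∈ nonemptyBounded X) → (∀ n, IsClosed (A n)) →
    (∀ n, A (n + 1) ⊆ A n) → Tendsto (fun n => μ (A n)) atTop (𝓝 0) → (⋂ n, A n).Nonempty

/-!
Let `E₀ = E` and let `Eₙ₊₁` be the closed convex hull of `T Eₙ` (`closedHullIterate`). The sequence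
decreases, and `μ (Eₙ₊₁) = μ (T Eₙ) ≤ k μ (Eₙ)` because `μ` does not see closures and convex hulls.
Hence `μ (Eₙ) → 0`, so that `⋂ Eₙ` is nonempty, convex, invariant under `T`, and of measure zero,
that is, compact. Schauder's theorem (`exists_fixedPoint_of_mapsTo_isCompact`) gives a fixed point
there.

Schauder's theorem follows from Brouwer's theorem on the standard simplex
(`exists_fixedPoint_of_mapsTo_stdSimplex`): a partition of unity subordinate to a finite cover by
`ε`-balls turns the map into a self-map of a simplex, whose fixed points are approximate fixed
points of the original map.

Brouwer's theorem is proved combinatorially, from Scarf's lemma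
(`exists_isDominant_image_eq_univ`). Instead of a triangulation one uses a finite set with one
ranking per coordinate. A set is dominant if no element is above all of its minima. Dominant sets
behave like the simplices of a triangulation: with as many elements as there are rankings they play
the role of the top-dimensional simplices, and with one element less they are facets, lying in
exactly two of these apart from a boundary case (`exists_pair_insert_isDominant_iff`). The parity
argument of Sperner's lemma then applies. On the grid of points of the simplex with denominator `N`,
a dominant set has diameter `O(1 / N)` (`exists_close_grid_points`).
-/

/-! ### Dominant sets and Scarf's lemma -/

section Dominant

variable {V ι : Type*}

/-- Given a ranking `r i` of `V` for every index `i`, a finite set `σ` is dominant if no `x : V`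
lies strictly above the `r i`-minimum of `σ` for all `i` simultaneously. -/
def IsDominant (r : ι → V → ℕ) (σ : Finset V) : Prop :=
  ∀ x, ∃ i, ∀ y ∈ σ, r i x ≤ r i y

theorem IsDominant.subset {r : ι → V → ℕ} {σ τ : Finset V} (h : IsDominant r τ) (hσ : σ ⊆ τ) :
    IsDominant r σ := fun x => (h x).imp fun _ hi y hy => hi y (hσ hy)

variable [DecidableEq V] [Fintype ι] [DecidableEq ι]

/-- Let `m i` be the `r i`-minimum of `σ` and suppose that `m i = m k`. Then `σ` can be extended
in exactly one way to a dominant set by an element that lowers the `i`-th minimum only: the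
candidates are the elements above all the other minima, and the `r i`-largest of them is the
one that works. -/
theorem exists_unique_insert_isDominant [Fintype V] {r : ι → V → ℕ}
    (hr : ∀ i, Function.Injective (r i))
    {σ : Finset V} (hσ : IsDominant r σ) {m : ι → V} (hm : ∀ i, ∀ y ∈ σ, r i (m i) ≤ r i y)
    (hmσ : ∀ i, m i ∈ σ) (hsurj : ∀ y ∈ σ, ∃ i, m i = y) {i k : ι} (hik : i ≠ k)
    (hmik : m i = m k) (hne : ∃ x, ∀ l, l ≠ i → r l (m l) < r l x) :
    ∃ a, a ∉ σ ∧ (∀ l, l ≠ i → r l (m l) < r l a) ∧ r i a ≤ r i (m i) ∧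
      IsDominant r (insert a σ) ∧
      ∀ y, (∀ l, l ≠ i → r l (m l) < r l y) → IsDominant r (insert y σ) → y = a := by
  classical
  obtain ⟨a, ha, hmax⟩ := Finset.exists_max_image
    (Finset.univ.filter fun x => ∀ l, l ≠ i → r l (m l) < r l x) (r i)
    (by obtain ⟨x, hx⟩ := hne; exact ⟨x, by simpa using hx⟩)
  simp only [Finset.mem_filter, Finset.mem_univ, true_and] at ha hmax
  have hle : r i a ≤ r i (m i) := by
    obtain ⟨l, hl⟩ := hσ a
    by_cases hli : l = i
    · subst hli; exact hl _ (hmσ l)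
    · exact absurd (hl _ (hmσ l)) (not_le.2 (ha l hli))
  refine ⟨a, fun haσ => ?_, ha, hle, fun y => ?_, fun y hy hdom => ?_⟩
  · obtain ⟨l, rfl⟩ := hsurj a haσ
    by_cases hli : l = i
    · subst hli
      have := ha k hik.symm
      rw [hmik] at this
      exact lt_irrefl _ this
    · exact lt_irrefl _ (ha l hli)
  · by_cases hy : ∀ l, l ≠ i → r l (m l) < r l y
    · refine ⟨i, fun z hz => ?_⟩
      rcases Finset.mem_insert.1 hz with rfl | hz
      · exact hmax y hy
      · exact (hmax y hy).trans (hle.trans (hm i z hz))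
    · push Not at hy
      obtain ⟨l, hli, hl⟩ := hy
      refine ⟨l, fun z hz => ?_⟩
      rcases Finset.mem_insert.1 hz with rfl | hz
      · exact hl.trans (ha l hli).le
      · exact hl.trans (hm l z hz)
  · refine hr i (le_antisymm (hmax y hy) ?_)
    obtain ⟨l, hl⟩ := hdom a
    by_cases hli : l = i
    · subst hli; exact hl y (Finset.mem_insert_self _ _)
    · exact absurd (hl _ (Finset.mem_insert_of_mem (hmσ l))) (not_le.2 (ha l hli))

/-- A dominant set with one element less than there are indices has two indices `i`, `k` with a
common minimum. Every dominant extension by one element lowers the minimum of exactly one of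
these, so there are exactly two, provided that (`hne`) the element that
`exists_unique_insert_isDominant` asks for exists in both cases. -/
theorem exists_pair_insert_isDominant_iff [Fintype V] {r : ι → V → ℕ}
    (hr : ∀ i, Function.Injective (r i)) {σ : Finset V} (hσ : IsDominant r σ)
    (hcard : σ.card + 1 = Fintype.card ι)
    (hσne : σ.Nonempty)
    (hne : ∀ m : ι → V, (∀ i, m i ∈ σ) → (∀ i, ∀ y ∈ σ, r i (m i) ≤ r i y) →
      ∀ i k, i ≠ k → m i = m k → ∃ x, ∀ l, l ≠ i → r l (m l) < r l x) :
    ∃ a b, a ≠ b ∧ ∀ y, (y ∉ σ ∧ IsDominant r (insert y σ)) ↔ y = a ∨ y = b := by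
  classical
  choose m hmσ hm using fun i => Finset.exists_min_image σ (r i) hσne
  have hsurj : ∀ y ∈ σ, ∃ i, m i = y := fun y hy => by
    obtain ⟨i, hi⟩ := hσ y
    exact ⟨i, hr i (le_antisymm (hm i y hy) (hi _ (hmσ i)))⟩
  obtain ⟨i, -, k, -, hik, hmik⟩ := Finset.exists_ne_map_eq_of_card_lt_of_maps_to
    (s := Finset.univ) (t := σ) (f := m) (by rw [Finset.card_univ]; omega)
    (fun i _ => hmσ i)
  -- Dropping one of the two indices with a common minimum makes `m` a bijection onto `σ`.
  have hinj : ∀ i k, i ≠ k → m i = m k → ∀ l j, l ≠ i → j ≠ i → m l = m j → l = j := by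
    intro i k hik hmik l j hl hj hlj
    refine Finset.injOn_of_surjOn_of_card_le (s := Finset.univ.erase i) (t := σ) m
      (fun x _ => hmσ x) (fun y hy => ?_) ?_ (by simpa using hl) (by simpa using hj) hlj
    · obtain ⟨x, rfl⟩ := hsurj y hy
      by_cases hx : x = i
      · subst hx; exact ⟨k, by simpa using hik.symm, hmik.symm⟩
      · exact ⟨x, by simpa using hx, rfl⟩
    · rw [Finset.card_erase_of_mem (Finset.mem_univ _), Finset.card_univ]; omega
  obtain ⟨a, haσ, hal, hai, had, hau⟩ := exists_unique_insert_isDominant hr hσ hm hmσ hsurj hik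
    hmik (hne m hmσ hm i k hik hmik)
  obtain ⟨b, hbσ, hbl, hbi, hbd, hbu⟩ := exists_unique_insert_isDominant hr hσ hm hmσ hsurj
    hik.symm hmik.symm (hne m hmσ hm k i hik.symm hmik.symm)
  refine ⟨a, b, fun hab => ?_, fun y => ⟨fun ⟨hyσ, hyd⟩ => ?_, ?_⟩⟩
  · subst hab; exact absurd (hal k hik.symm) (not_lt.2 hbi)
  · obtain ⟨j, hj⟩ := hyd y
    -- Every element of `σ` is still the minimum of the extended set for an index other than `j`.
    have key : ∀ l, ∃ j', j' ≠ j ∧ m l = m j' ∧ r j' (m j') < r j' y := by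
      intro l
      obtain ⟨j', hj'⟩ := hyd (m l)
      have h1 : m l = m j' := hr j' (le_antisymm
        (hj' _ (Finset.mem_insert_of_mem (hmσ j'))) (hm j' _ (hmσ l)))
      have h2 := hj' y (Finset.mem_insert_self _ _)
      rw [h1] at h2
      have h3 : r j' (m j') < r j' y :=
        lt_of_le_of_ne h2 fun h => hyσ (hr j' h ▸ hmσ j')
      refine ⟨j', ?_, h1, h3⟩
      rintro rfl
      exact absurd (hj _ (Finset.mem_insert_of_mem (hmσ j'))) (not_le.2 h3)
    have habove : ∀ k', j ≠ k' → m j = m k' → ∀ l, l ≠ j → r l (m l) < r l y := by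
      intro k' hjk hmjk l hl
      obtain ⟨j', hj', hlj', hlt⟩ := key l
      rw [hinj j k' hjk hmjk l j' hl hj' hlj']
      exact hlt
    obtain ⟨j', hj', hjj', -⟩ := key j
    by_cases hji : j = i
    · subst hji; exact Or.inl (hau y (habove k hik hmik) hyd)
    · by_cases hjk : j = k
      · subst hjk; exact Or.inr (hbu y (habove i hik.symm hmik.symm) hyd)
      · exfalso
        have h1 := hinj j j' hj'.symm hjj' i k (Ne.symm hji) (Ne.symm hjk) hmik
        exact hik h1
  · rintro (rfl | rfl)
    exacts [⟨haσ, had⟩, ⟨hbσ, hbd⟩]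

/-- If a set of as many elements as there are colours does not carry all colours, then the
number of its elements whose removal leaves exactly the colours other than `i₀` is even (it is
zero or two). -/
theorem even_card_filter_image_erase (c : V → ι) (i₀ : ι) {τ : Finset V}
    (hcard : τ.card = Fintype.card ι) (hτ : τ.image c ≠ Finset.univ) :
    Even (τ.filter fun x => (τ.erase x).image c = Finset.univ.erase i₀).card := by
  rcases Finset.eq_empty_or_nonempty
    (τ.filter fun x => (τ.erase x).image c = Finset.univ.erase i₀) with h | ⟨x, hx⟩
  · simp [h]
  obtain ⟨hxτ, hx⟩ := Finset.mem_filter.1 hx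
  have himg : τ.image c = insert (c x) (Finset.univ.erase i₀) := by
    rw [← hx, ← Finset.image_insert, Finset.insert_erase hxτ]
  have hcx : c x ≠ i₀ := by
    intro h
    rw [h, Finset.insert_erase (Finset.mem_univ _)] at himg
    exact hτ himg
  have hinj : Set.InjOn c (τ.erase x) := by
    refine Finset.card_image_iff.1 ?_
    rw [hx, Finset.card_erase_of_mem (Finset.mem_univ _), Finset.card_erase_of_mem hxτ, hcard,
      Finset.card_univ]
  obtain ⟨x', hx', hcx'⟩ : ∃ x' ∈ τ.erase x, c x' = c x := by
    rw [← Finset.mem_image, hx]; simp [hcx]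
  obtain ⟨hx'x, hx'τ⟩ := Finset.mem_erase.1 hx'
  have hfil : τ.filter (fun x => (τ.erase x).image c = Finset.univ.erase i₀) = {x, x'} := by
    ext y
    simp only [Finset.mem_filter, Finset.mem_insert, Finset.mem_singleton]
    constructor
    · rintro ⟨hyτ, hy⟩
      by_contra! hne
      have hcy : c y ∈ (τ.erase y).image c := by
        rw [hy]
        refine Finset.mem_erase.2 ⟨fun h => ?_, Finset.mem_univ _⟩
        have : c y ∈ (τ.erase x).image c :=
          Finset.mem_image_of_mem _ (Finset.mem_erase.2 ⟨hne.1, hyτ⟩)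
        rw [hx, h] at this
        simp at this
      obtain ⟨z, hz, hzy⟩ := Finset.mem_image.1 hcy
      obtain ⟨hzy', hzτ⟩ := Finset.mem_erase.1 hz
      by_cases hzx : z = x
      · subst hzx
        exact hne.2 (hinj (Finset.mem_coe.2 (Finset.mem_erase.2 ⟨hne.1, hyτ⟩)) hx'
          (hzy.symm.trans hcx'.symm))
      · exact hzy' (hinj (Finset.mem_coe.2 (Finset.mem_erase.2 ⟨hzx, hzτ⟩))
          (Finset.mem_coe.2 (Finset.mem_erase.2 ⟨hne.1, hyτ⟩)) hzy)
    · rintro (rfl | rfl)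
      · exact ⟨hxτ, hx⟩
      · refine ⟨hx'τ, ?_⟩
        rw [← hx]
        ext j
        simp only [Finset.mem_image, Finset.mem_erase]
        constructor
        · rintro ⟨z, ⟨hz, hzτ⟩, rfl⟩
          by_cases hzx : z = x
          · exact ⟨y, ⟨hx'x, hx'τ⟩, by rw [hzx, hcx']⟩
          · exact ⟨z, ⟨hzx, hzτ⟩, rfl⟩
        · rintro ⟨z, ⟨hz, hzτ⟩, rfl⟩
          by_cases hzx : z = y
          · exact ⟨x, ⟨hx'x.symm, hxτ⟩, by rw [hzx, hcx']⟩
          · exact ⟨z, ⟨hzx, hzτ⟩, rfl⟩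
  rw [hfil, Finset.card_pair hx'x.symm]
  exact even_two

/-- Scarf's lemma. The `s i` are slack elements: `s i` is the least element of the `i`-th
ranking, it is above all non-slack elements in the other rankings, and it has colour `i`. The
conclusion is a dominant set on which the colouring `c` is a bijection onto the indices. -/
theorem exists_isDominant_image_eq_univ [Fintype V] {r : ι → V → ℕ}
    (hr : ∀ i, Function.Injective (r i)) (s : ι → V) (hs : ∀ i v, r i (s i) ≤ r i v)
    (hs' : ∀ i l v, l ≠ i → v ∉ Set.range s → r i v < r i (s l))
    {p₀ : V} (hp₀ : p₀ ∉ Set.range s) (c : V → ι) (hc : ∀ i, c (s i) = i) (i₀ : ι) :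
    ∃ τ : Finset V, τ.card = Fintype.card ι ∧ τ.image c = Finset.univ ∧ IsDominant r τ := by
  classical
  by_contra! hno
  -- If there is no such set, double counting the pairs `σ ⊆ τ` with `σ ∈ D`, `τ ∈ R` gives a
  -- contradiction: every `τ` has an even number of `σ` below it, and every `σ` an even number of
  -- `τ` above it, with the exception of the set `σ₀` of all slack elements but `s i₀`, which lies
  -- in one `τ` only.
  let D : Finset (Finset V) := Finset.univ.filter fun σ =>
    IsDominant r σ ∧ σ.card + 1 = Fintype.card ι ∧ σ.image c = Finset.univ.erase i₀
  let R : Finset (Finset V) := Finset.univ.filter fun τ =>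
    IsDominant r τ ∧ τ.card = Fintype.card ι
  have hsinj : Function.Injective s := fun i j h => by rw [← hc i, h, hc j]
  have hs_lt : ∀ i v, v ≠ s i → r i (s i) < r i v := fun i v hv =>
    lt_of_le_of_ne (hs i v) fun h => hv (hr i h).symm
  have hcount := Finset.sum_card_bipartiteAbove_eq_sum_card_bipartiteBelow
    (s := D) (t := R) (fun σ τ => σ ⊆ τ)
  have heven : Even (∑ τ ∈ R, (Finset.bipartiteBelow (fun σ τ => σ ⊆ τ) D τ).card) := by
    refine Finset.even_sum _ fun τ hτ => ?_
    obtain ⟨hdom, hcard⟩ := (Finset.mem_filter.1 hτ).2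
    have := even_card_filter_image_erase c i₀ hcard fun h => hno τ hcard h hdom
    refine (congrArg Even ?_).mp this
    refine Finset.card_bij (fun x _ => τ.erase x) (fun x hx => ?_) (fun x hx y hy hxy => ?_)
      fun σ hσ => ?_
    · obtain ⟨hxτ, hx⟩ := Finset.mem_filter.1 hx
      refine Finset.mem_filter.2 ⟨Finset.mem_filter.2 ⟨Finset.mem_univ _,
        hdom.subset (Finset.erase_subset _ _), ?_, hx⟩, Finset.erase_subset _ _⟩
      rw [Finset.card_erase_add_one hxτ, hcard]
    · exact Finset.erase_injOn _ (Finset.mem_filter.1 hx).1 (Finset.mem_filter.1 hy).1 hxy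
    · obtain ⟨hσD, hστ⟩ := Finset.mem_filter.1 hσ
      obtain ⟨-, hσ1, hσ2⟩ := (Finset.mem_filter.1 hσD).2
      obtain ⟨x, hxσ, rfl⟩ := Finset.covBy_iff_exists_insert.1
        (Finset.covBy_iff_card_sdiff_eq_one.2 ⟨hστ, by
          rw [Finset.card_sdiff_of_subset hστ]; omega⟩)
      exact ⟨x, Finset.mem_filter.2 ⟨Finset.mem_insert_self _ _, by
        rwa [Finset.erase_insert hxσ]⟩, Finset.erase_insert hxσ⟩
  have habove : ∀ σ ∈ D, (Finset.bipartiteAbove (fun σ τ => σ ⊆ τ) R σ).card =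
      (Finset.univ.filter fun y => y ∉ σ ∧ IsDominant r (insert y σ)).card := by
    intro σ hσ
    obtain ⟨-, hσ1, hσ2⟩ := (Finset.mem_filter.1 hσ).2
    symm
    refine Finset.card_bij (fun y _ => insert y σ) (fun y hy => ?_) (fun x hx y hy hxy => ?_)
      fun τ hτ => ?_
    · obtain ⟨hyσ, hy⟩ := (Finset.mem_filter.1 hy).2
      refine Finset.mem_filter.2 ⟨Finset.mem_filter.2 ⟨Finset.mem_univ _, hy, ?_⟩,
        Finset.subset_insert _ _⟩
      rw [Finset.card_insert_of_notMem hyσ, hσ1]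
    · exact (Finset.insert_inj (Finset.mem_filter.1 hx).2.1).1 hxy
    · obtain ⟨hτR, hστ⟩ := Finset.mem_filter.1 hτ
      obtain ⟨hτ1, hτ2⟩ := (Finset.mem_filter.1 hτR).2
      obtain ⟨x, hxσ, rfl⟩ := Finset.covBy_iff_exists_insert.1
        (Finset.covBy_iff_card_sdiff_eq_one.2 ⟨hστ, by
          rw [Finset.card_sdiff_of_subset hστ]; omega⟩)
      exact ⟨x, Finset.mem_filter.2 ⟨Finset.mem_univ _, hxσ, hτ1⟩, rfl⟩
  set σ₀ : Finset V := (Finset.univ.erase i₀).image s with hσ₀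
  have hmemσ₀ : ∀ v, v ∈ σ₀ ↔ ∃ l, l ≠ i₀ ∧ s l = v := fun v => by simp [hσ₀]
  have hσ₀D : σ₀ ∈ D := by
    refine Finset.mem_filter.2 ⟨Finset.mem_univ _, fun x => ?_, ?_, ?_⟩
    · by_cases hx : x ∈ Set.range s
      · obtain ⟨i, rfl⟩ := hx
        exact ⟨i, fun y _ => hs i y⟩
      · refine ⟨i₀, fun y hy => ?_⟩
        obtain ⟨l, hl, rfl⟩ := (hmemσ₀ y).1 hy
        exact (hs' i₀ l x hl hx).le
    · rw [hσ₀, Finset.card_image_of_injective _ hsinj,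
        Finset.card_erase_add_one (Finset.mem_univ _), Finset.card_univ]
    · rw [hσ₀, Finset.image_image]
      have : c ∘ s = id := funext hc
      rw [this, Finset.image_id]
  -- The only element extending `σ₀` is the `r i₀`-largest non-slack element.
  have hone : (Finset.univ.filter fun y => y ∉ σ₀ ∧ IsDominant r (insert y σ₀)).card = 1 := by
    obtain ⟨p, hp, hmax⟩ := Finset.exists_max_image
      (Finset.univ.filter fun x => x ∉ Set.range s) (r i₀) ⟨p₀, by simpa using hp₀⟩
    replace hp := (Finset.mem_filter.1 hp).2
    rw [Finset.card_eq_one]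
    refine ⟨p, ?_⟩
    ext y
    simp only [Finset.mem_filter, Finset.mem_univ, true_and, Finset.mem_singleton]
    constructor
    · rintro ⟨hyσ, hy⟩
      obtain ⟨i, hi⟩ := hy p
      have hii₀ : i = i₀ := by
        by_contra h
        have h1 := hi (s i) (Finset.mem_insert_of_mem ((hmemσ₀ _).2 ⟨i, h, rfl⟩))
        exact absurd h1 (not_le.2 (hs_lt i p fun h => hp ⟨i, h.symm⟩))
      subst hii₀
      have h1 := hi y (Finset.mem_insert_self _ _)
      refine hr i (le_antisymm (hmax y ?_) h1)
      refine Finset.mem_filter.2 ⟨Finset.mem_univ _, ?_⟩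
      rintro ⟨l, rfl⟩
      by_cases hl : l = i
      · subst hl
        exact absurd h1 (not_le.2 (hs_lt l p fun h => hp ⟨l, h.symm⟩))
      · exact hyσ ((hmemσ₀ _).2 ⟨l, hl, rfl⟩)
    · rintro rfl
      refine ⟨fun h => ?_, fun x => ?_⟩
      · obtain ⟨l, -, h⟩ := (hmemσ₀ _).1 h
        exact hp ⟨l, h⟩
      · by_cases hx : x ∈ Set.range s
        · obtain ⟨i, rfl⟩ := hx
          exact ⟨i, fun y _ => hs i y⟩
        · refine ⟨i₀, fun z hz => ?_⟩
          rcases Finset.mem_insert.1 hz with rfl | hz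
          · exact hmax x (by simpa using hx)
          · obtain ⟨l, hl, rfl⟩ := (hmemσ₀ z).1 hz
            exact (hs' i₀ l x hl hx).le
  have htwo : ∀ σ ∈ D.erase σ₀, Even (Finset.bipartiteAbove (fun σ τ => σ ⊆ τ) R σ).card := by
    intro σ hσ
    obtain ⟨hσne, hσD⟩ := Finset.mem_erase.1 hσ
    rw [habove σ hσD]
    obtain ⟨hdom, hcard, hcol⟩ := (Finset.mem_filter.1 hσD).2
    -- A set in `D` of slack elements only has the colours, hence the elements, of `σ₀`.
    obtain ⟨p, hpσ, hp⟩ : ∃ p ∈ σ, p ∉ Set.range s := by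
      by_contra! hall
      refine hσne (Finset.ext fun v => ?_)
      rw [hmemσ₀]
      constructor
      · intro hv
        obtain ⟨l, rfl⟩ := hall v hv
        refine ⟨l, ?_, rfl⟩
        have : c (s l) ∈ σ.image c := Finset.mem_image_of_mem _ hv
        rw [hcol, hc] at this
        exact (Finset.mem_erase.1 this).1
      · rintro ⟨l, hl, rfl⟩
        have : l ∈ σ.image c := by rw [hcol]; simp [hl]
        obtain ⟨v, hv, rfl⟩ := Finset.mem_image.1 this
        obtain ⟨j, rfl⟩ := hall v hv
        rwa [hc]
    obtain ⟨a, b, hab, hiff⟩ := exists_pair_insert_isDominant_iff hr hdom hcard ⟨p, hpσ⟩ (by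
      intro m hmσ hm i k hik hmik
      have hslack : ∀ j l, m j = s l → l = j := by
        intro j l h
        by_contra hlj
        have := hm j p hpσ
        rw [h] at this
        exact absurd this (not_le.2 (hs' j l p hlj hp))
      -- As `σ` has a non-slack element, the slack element `s i` is above all minima but the `i`-th.
      refine ⟨s i, fun l hl => ?_⟩
      by_cases h : m l ∈ Set.range s
      · obtain ⟨j, hj⟩ := h
        have := hslack l j hj.symm
        subst this
        rw [← hj]
        exact hs_lt j _ fun h => hl (hsinj h).symm
      · exact hs' l i (m l) (Ne.symm hl) h)
    have : (Finset.univ.filter fun y => y ∉ σ ∧ IsDominant r (insert y σ)) = {a, b} := by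
      ext y; simp [hiff y]
    rw [this, Finset.card_pair hab]
    exact even_two
  rw [← Finset.add_sum_erase _ _ hσ₀D, habove σ₀ hσ₀D, hone] at hcount
  rw [← hcount, Nat.even_add] at heven
  exact Nat.not_even_one (heven.2 (Finset.even_sum _ htwo))

end Dominant

/-! ### Brouwer's fixed point theorem on the standard simplex -/

section Brouwer

variable {ι : Type*} [Fintype ι] [DecidableEq ι]

/-- Scarf's lemma on the grid of points of `ℕ^ι` with coordinate sum `N`, ranked by each
coordinate: for every colouring there are grid points of all colours from some set `J` which lie
within a distance that does not depend on `N`, and whose coordinates outside `J` are small. -/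
theorem exists_close_grid_points [Nonempty ι] (N : ℕ) (c : (ι → ℕ) → ι) :
    ∃ (m : ι → ℕ) (J : Finset ι) (q : ι → ι → ℕ), J.Nonempty ∧ (∀ i ∉ J, m i = 0) ∧
      ∀ j ∈ J, ∑ i, q j i = N ∧ c (q j) = j ∧
        ∀ i, m i ≤ q j i ∧ q j i ≤ m i + Fintype.card ι := by
  classical
  let P := ↥(Finset.piAntidiag (Finset.univ : Finset ι) N)
  have hP : ∀ p : P, ∑ i, p.1 i = N := fun p => (Finset.mem_piAntidiag.1 p.2).1
  have hPN : ∀ (p : P) i, p.1 i ≤ N := fun p i =>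
    (Finset.single_le_sum (fun _ _ => Nat.zero_le _) (Finset.mem_univ i)).trans (hP p).le
  let M := Fintype.card P
  let e : P ≃ Fin M := Fintype.equivFin P
  let d : ι ≃ Fin (Fintype.card ι) := Fintype.equivFin ι
  -- Rank by the `i`-th coordinate, ties being broken by the enumeration `e`; `Sum.inr i` is the
  -- slack element with index `i`.
  let r : ι → P ⊕ ι → ℕ := fun i => Sum.elim (fun p => 1 + (p.1 i * M + e p))
    (fun l => if l = i then 0 else 1 + (N + 1) * M + d l)
  have hrl : ∀ i p, r i (Sum.inl p) = 1 + (p.1 i * M + e p) := fun _ _ => rfl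
  have hrr : ∀ i l, r i (Sum.inr l) = if l = i then 0 else 1 + (N + 1) * M + d l :=
    fun _ _ => rfl
  have hlt : ∀ i p, r i (Sum.inl p) < 1 + (N + 1) * M := by
    intro i p
    rw [hrl]
    have h1 := Nat.mul_le_mul_right M (hPN p i)
    have h2 := (e p).2
    rw [add_mul]; omega
  have hmono : ∀ i (p q : P), r i (Sum.inl p) ≤ r i (Sum.inl q) → p.1 i ≤ q.1 i := by
    intro i p q h
    rw [hrl, hrl] at h
    have h2 := (e q).2
    refine Nat.lt_succ_iff.1 (Nat.lt_of_mul_lt_mul_right (a := M) ?_)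
    rw [Nat.succ_mul]; omega
  have hr : ∀ i, Function.Injective (r i) := by
    rintro i (p | l) (q | l') h
    · have h1 : p.1 i = q.1 i := le_antisymm (hmono i p q h.le) (hmono i q p h.ge)
      rw [hrl, hrl, h1] at h
      exact congrArg _ (e.injective (Fin.ext (by omega)))
    · have := hlt i p
      rw [h, hrr] at this
      rw [hrl, hrr] at h
      split_ifs at this h <;> omega
    · have := hlt i q
      rw [← h, hrr] at this
      rw [hrl, hrr] at h
      split_ifs at this h <;> omega
    · rw [hrr, hrr] at h
      split_ifs at h with h1 h2 h2
      · rw [h1, h2]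
      · omega
      · omega
      · exact congrArg _ (d.injective (Fin.ext (by omega)))
  have hp₀ : ∃ p₀ : P, True := by
    obtain ⟨i⟩ := ‹Nonempty ι›
    exact ⟨⟨Pi.single i N, Finset.mem_piAntidiag.2 ⟨by simp, by simp⟩⟩, trivial⟩
  obtain ⟨p₀, -⟩ := hp₀
  obtain ⟨τ, -, hτc, hτ⟩ := exists_isDominant_image_eq_univ hr Sum.inr
    (fun i v => by rw [hrr, if_pos rfl]; exact Nat.zero_le _)
    (fun i l v hl hv => by
      rcases v with p | j
      · rw [hrr, if_neg hl]
        exact (hlt i p).trans_le (Nat.le_add_right _ _)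
      · exact absurd ⟨j, rfl⟩ hv)
    (p₀ := Sum.inl p₀) (by simp) (Sum.elim (fun p => c p.1) id) (fun _ => rfl)
    (Classical.arbitrary ι)
  let J : Finset ι := Finset.univ.filter fun i => Sum.inr i ∉ τ
  have hq : ∀ j, ∃ q : P, j ∈ J → Sum.inl q ∈ τ ∧ c q.1 = j := by
    intro j
    by_cases hj : j ∈ J
    · obtain ⟨v, hv, hvj⟩ := Finset.mem_image.1 (hτc ▸ Finset.mem_univ j)
      rcases v with q | l
      · exact ⟨q, fun _ => ⟨hv, hvj⟩⟩
      · obtain rfl : l = j := hvj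
        exact absurd hv (Finset.mem_filter.1 hj).2
    · exact ⟨p₀, fun h => absurd h hj⟩
  choose q hq using hq
  have hdom : ∀ p : P, ∃ i ∈ J, ∀ j ∈ J, p.1 i ≤ (q j).1 i := by
    intro p
    obtain ⟨i, hi⟩ := hτ (Sum.inl p)
    refine ⟨i, Finset.mem_filter.2 ⟨Finset.mem_univ _, fun h => ?_⟩, fun j hj =>
      hmono i _ _ (hi _ (hq j hj).1)⟩
    have := hi _ h
    rw [hrl, hrr, if_pos rfl] at this
    omega
  obtain ⟨j₁, hj₁, -⟩ := hdom p₀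
  choose j₀ hj₀ hmin using fun i => Finset.exists_min_image J (fun j => (q j).1 i) ⟨j₁, hj₁⟩
  let m : ι → ℕ := fun i => if i ∈ J then (q (j₀ i)).1 i else 0
  have hmq : ∀ j ∈ J, ∀ i, m i ≤ (q j).1 i := by
    intro j hj i
    by_cases hi : i ∈ J
    · simpa [m, hi] using hmin i j hj
    · simp [m, hi]
  -- Otherwise some grid point would exceed all the minima `m i` with `i ∈ J`.
  have hsum : N < ∑ i, (m i + 1) := by
    refine lt_of_lt_of_le ?_ (Finset.sum_le_sum_of_subset (Finset.subset_univ J))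
    by_contra! hle
    obtain ⟨i, hi, hij⟩ := hdom ⟨(fun i => if i ∈ J then m i + 1 else 0) +
      Pi.single j₁ (N - ∑ i ∈ J, (m i + 1)), Finset.mem_piAntidiag.2 ⟨by
        simp only [Pi.add_apply, Finset.sum_add_distrib, Finset.sum_pi_single', Finset.sum_ite_mem,
          Finset.univ_inter, Finset.mem_univ, if_true] at hle ⊢
        omega, by simp⟩⟩
    have := hij _ (hj₀ i)
    simp only [Pi.add_apply, if_pos hi, m] at this
    omega
  refine ⟨m, J, fun j => (q j).1, ⟨j₁, hj₁⟩, fun i hi => if_neg hi, fun j hj =>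
    ⟨hP _, (hq j hj).2, fun i => ⟨hmq j hj i, ?_⟩⟩⟩
  by_contra! hlt'
  have h1 : ∑ l, (m l + if l = i then Fintype.card ι else 0) ≤ ∑ l, (q j).1 l := by
    refine Finset.sum_le_sum fun l _ => ?_
    split_ifs with h
    · subst h; exact hlt'.le
    · exact hmq j hj l
  rw [hP, Finset.sum_add_distrib, Finset.sum_ite_eq' Finset.univ i,
    if_pos (Finset.mem_univ _)] at h1
  rw [Finset.sum_add_distrib, Finset.sum_const, Finset.card_univ] at hsum
  simp only [smul_eq_mul, mul_one] at hsum
  omega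

/-- A continuous self-map of the simplex has a point that is, up to `ε`, coordinatewise below
its image. A grid point `p / N` gets the colour of a coordinate which does not decrease under
`f`; differently coloured nearby points give the bounds for the different coordinates. -/
theorem exists_le_apply_add_of_mapsTo_stdSimplex [Nonempty ι] {f : (ι → ℝ) → ι → ℝ}
    (hf : ContinuousOn f (stdSimplex ℝ ι))
    (hmaps : Set.MapsTo f (stdSimplex ℝ ι) (stdSimplex ℝ ι)) {ε : ℝ} (hε : 0 < ε) :
    ∃ x ∈ stdSimplex ℝ ι, ∀ i, x i ≤ f x i + ε := by
  obtain ⟨δ, hδ, hδf⟩ := Metric.uniformContinuousOn_iff.1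
    ((isCompact_stdSimplex ℝ ι).uniformContinuousOn_of_continuous hf) (ε / 2) (half_pos hε)
  obtain ⟨N, hN⟩ := exists_nat_gt ((Fintype.card ι : ℝ) / min δ (ε / 2))
  have hmin : 0 < min δ (ε / 2) := lt_min hδ (half_pos hε)
  have hN0 : (0 : ℝ) < N := lt_of_le_of_lt (by positivity) hN
  have hnN : (Fintype.card ι : ℝ) / N < min δ (ε / 2) := by
    rw [div_lt_iff₀ hmin] at hN
    rw [div_lt_iff₀ hN0]; linarith
  let y : (ι → ℕ) → ι → ℝ := fun p i => p i / N
  have hy : ∀ p : ι → ℕ, ∑ i, p i = N → y p ∈ stdSimplex ℝ ι := fun p hp =>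
    ⟨fun i => by positivity, by
      simp only [y]
      rw [← Finset.sum_div, ← Nat.cast_sum, hp, div_self hN0.ne']⟩
  have hcol : ∀ p : ι → ℕ, ∃ i, ∑ i, p i = N → y p i ≤ f (y p) i := by
    intro p
    by_cases hp : ∑ i, p i = N
    · by_contra! h
      have h1 : ∑ i, f (y p) i < ∑ i, y p i :=
        Finset.sum_lt_sum_of_nonempty Finset.univ_nonempty fun i _ => (h i).2
      rw [(hy p hp).2, (hmaps (hy p hp)).2] at h1
      exact lt_irrefl _ h1
    · exact ⟨Classical.arbitrary ι, fun h => absurd h hp⟩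
  choose c hc using hcol
  obtain ⟨m, J, q, ⟨j, hj⟩, hm, hq⟩ := exists_close_grid_points N c
  have hclose : ∀ j ∈ J, ∀ j' ∈ J, ∀ i, y (q j) i ≤ y (q j') i + Fintype.card ι / N := by
    intro j hj j' hj' i
    simp only [y]
    rw [← add_div]
    gcongr
    have h1 := ((hq j hj).2.2 i).2
    have h2 := ((hq j' hj').2.2 i).1
    exact_mod_cast h1.trans (Nat.add_le_add_right h2 _)
  refine ⟨y (q j), hy _ (hq j hj).1, fun i => ?_⟩
  have hlt := hnN.trans_le (min_le_right _ _)
  by_cases hi : i ∈ J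
  · have h1 := hclose j hj i hi i
    have h2 := hc (q i) (hq i hi).1
    rw [(hq i hi).2.1] at h2
    have h3 : dist (f (y (q i))) (f (y (q j))) < ε / 2 := by
      refine hδf _ (hy _ (hq i hi).1) _ (hy _ (hq j hj).1) ((dist_pi_lt_iff hδ).2 fun l => ?_)
      rw [Real.dist_eq]
      refine lt_of_le_of_lt (abs_sub_le_iff.2 ⟨?_, ?_⟩) (hnN.trans_le (min_le_left _ _))
      · linarith [hclose i hi j hj l]
      · linarith [hclose j hj i hi l]
    have h4 := (dist_le_pi_dist (f (y (q i))) (f (y (q j))) i).trans_lt h3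
    rw [Real.dist_eq] at h4
    linarith [(abs_lt.1 h4).2]
  · have h1 := ((hq j hj).2.2 i).2
    rw [hm i hi, zero_add] at h1
    have h2 : y (q j) i ≤ Fintype.card ι / N := by
      simp only [y]
      gcongr
    have h3 := (hmaps (hy _ (hq j hj).1)).1 i
    linarith

/-- **Brouwer's fixed point theorem** for the standard simplex. -/
theorem exists_fixedPoint_of_mapsTo_stdSimplex [Nonempty ι] {f : (ι → ℝ) → ι → ℝ}
    (hf : ContinuousOn f (stdSimplex ℝ ι))
    (hmaps : Set.MapsTo f (stdSimplex ℝ ι) (stdSimplex ℝ ι)) :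
    ∃ x ∈ stdSimplex ℝ ι, f x = x := by
  -- The total excess of `x` over `f x` attains its minimum, which is zero; both points have
  -- coordinate sum one, so `x ≤ f x` forces equality.
  let g : (ι → ℝ) → ℝ := fun x => ∑ i, max (x i - f x i) 0
  have hg : ContinuousOn g (stdSimplex ℝ ι) := by
    refine continuousOn_finsetSum _ fun i _ => ContinuousOn.sup (ContinuousOn.sub ?_ ?_) ?_
    · exact (continuous_apply i).continuousOn
    · exact (continuous_apply i).comp_continuousOn hf
    · exact continuousOn_const
  obtain ⟨x₀, hx₀, -⟩ := exists_le_apply_add_of_mapsTo_stdSimplex hf hmaps one_pos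
  obtain ⟨x, hx, hmin⟩ := (isCompact_stdSimplex ℝ ι).exists_isMinOn ⟨x₀, hx₀⟩ hg
  have hgx : g x ≤ 0 := by
    refine le_of_forall_pos_le_add fun ε hε => ?_
    have hn : (0 : ℝ) < Fintype.card ι := by exact_mod_cast Fintype.card_pos
    obtain ⟨z, hz, hzε⟩ := exists_le_apply_add_of_mapsTo_stdSimplex hf hmaps (div_pos hε hn)
    have h1 : g z ≤ ∑ _i : ι, ε / Fintype.card ι :=
      Finset.sum_le_sum fun i _ => max_le (by linarith [hzε i]) (by positivity)
    rw [Finset.sum_const, Finset.card_univ, nsmul_eq_mul, mul_div_cancel₀ _ hn.ne'] at h1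
    rw [zero_add]
    exact (hmin hz).trans h1
  have hle : ∀ i, x i ≤ f x i := by
    intro i
    have h1 : max (x i - f x i) 0 ≤ g x :=
      Finset.single_le_sum (f := fun i => max (x i - f x i) 0)
        (fun _ _ => le_max_right _ _) (Finset.mem_univ i)
    linarith [le_max_left (x i - f x i) 0]
  have heq := (Finset.sum_eq_sum_iff_of_le fun i _ => hle i).1
    ((hx.2).trans (hmaps hx).2.symm)
  exact ⟨x, hx, funext fun i => (heq i (Finset.mem_univ i)).symm⟩

end Brouwer

/-! ### Schauder's fixed point theorem -/

section Schauder

variable {X : Type*} [NormedAddCommGroup X] [NormedSpace ℝ X]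

/-- A continuous self-map of a compact convex set has approximate fixed points: up to `ε`, the
set is the image of a simplex spanned by the centres of a finite cover by `ε`-balls, and a
partition of unity subordinate to the cover lifts the map to this simplex. -/
theorem exists_norm_sub_le_of_mapsTo_isCompact {K : Set X} (hK : IsCompact K)
    (hKc : Convex ℝ K) (hKne : K.Nonempty) {T : X → X} (hT : ContinuousOn T K)
    (hmaps : Set.MapsTo T K K) {ε : ℝ} (hε : 0 < ε) : ∃ x ∈ K, ‖x - T x‖ ≤ ε := by
  classical
  obtain ⟨t, htK, htfin, hcover⟩ := hK.finite_cover_balls hε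
  have : Fintype t := htfin.fintype
  let φ : t → X → ℝ := fun i z => max (ε - dist z i) 0
  have hφ0 : ∀ i z, 0 ≤ φ i z := fun i z => le_max_right _ _
  have hφc : ∀ i, Continuous (φ i) := fun i => by fun_prop
  have hpos : ∀ z ∈ K, 0 < ∑ i, φ i z := by
    intro z hz
    obtain ⟨i, hi, hzi⟩ := Set.mem_iUnion₂.1 (hcover hz)
    refine Finset.sum_pos' (fun i _ => hφ0 i z) ⟨⟨i, hi⟩, Finset.mem_univ _, ?_⟩
    exact lt_max_of_lt_left (sub_pos.2 hzi)
  let w : X → t → ℝ := fun z i => φ i z / ∑ j, φ j z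
  have hw : Set.MapsTo w K (stdSimplex ℝ t) := fun z hz =>
    ⟨fun i => div_nonneg (hφ0 i z) (hpos z hz).le, by
      simp only [w]
      rw [← Finset.sum_div, div_self (hpos z hz).ne']⟩
  have hwc : ContinuousOn w K := continuousOn_pi.2 fun i =>
    (hφc i).continuousOn.div (continuous_finsetSum _ fun j _ => hφc j).continuousOn
      fun z hz => (hpos z hz).ne'
  let g : (t → ℝ) → X := fun a => ∑ i, a i • (i : X)
  have hgc : Continuous g := by fun_prop
  have hg : Set.MapsTo g (stdSimplex ℝ t) K := fun a ha =>
    hKc.sum_mem (fun i _ => ha.1 i) ha.2 fun i _ => htK i.2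
  have hne : Nonempty t := by
    obtain ⟨z, hz⟩ := hKne
    obtain ⟨i, hi, -⟩ := Set.mem_iUnion₂.1 (hcover hz)
    exact ⟨⟨i, hi⟩⟩
  obtain ⟨a, ha, hfix⟩ := exists_fixedPoint_of_mapsTo_stdSimplex
    (f := fun a => w (T (g a)))
    (hwc.comp (hT.comp hgc.continuousOn hg) (hmaps.comp hg)) (hw.comp (hmaps.comp hg))
  refine ⟨g a, hg ha, ?_⟩
  set z := T (g a) with hz
  have hzK : z ∈ K := hmaps (hg ha)
  have hga : g a - z = ∑ i, w z i • ((i : X) - z) := by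
    have h1 : g a = g (w z) := congrArg g hfix.symm
    simp only [smul_sub, Finset.sum_sub_distrib, ← Finset.sum_smul]
    rw [(hw hzK).2, one_smul, h1]
  rw [hga]
  calc ‖∑ i, w z i • ((i : X) - z)‖ ≤ ∑ i, w z i * ε := by
        refine norm_sum_le_of_le _ fun i _ => ?_
        have h0 := (hw hzK).1 i
        rw [norm_smul, Real.norm_of_nonneg h0]
        -- The weight vanishes at the centres that are not within `ε` of `z`.
        by_cases hi : dist z i ≤ ε
        · rw [← dist_eq_norm, dist_comm]
          exact mul_le_mul_of_nonneg_left hi h0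
        · have : w z i = 0 := by
            simp only [w, φ]
            rw [max_eq_right (by linarith), zero_div]
          simp [this]
    _ = ε := by rw [← Finset.sum_mul, (hw hzK).2, one_mul]

/-- **Schauder's fixed point theorem** for compact convex subsets of normed spaces. -/
theorem exists_fixedPoint_of_mapsTo_isCompact {K : Set X} (hK : IsCompact K)
    (hKc : Convex ℝ K) (hKne : K.Nonempty) {T : X → X} (hT : ContinuousOn T K)
    (hmaps : Set.MapsTo T K K) : ∃ x ∈ K, T x = x := by
  obtain ⟨x, hx, hmin⟩ := hK.exists_isMinOn hKne (continuousOn_id.sub hT).norm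
  refine ⟨x, hx, (sub_eq_zero.1 (norm_le_zero_iff.1 ?_)).symm⟩
  refine le_of_forall_pos_le_add fun ε hε => ?_
  obtain ⟨y, hy, hyε⟩ := exists_norm_sub_le_of_mapsTo_isCompact hK hKc hKne hT hmaps hε
  rw [zero_add]
  exact (hmin hy).trans hyε

end Schauder

/-! ### Darbo's fixed point theorem -/

section Darbo

variable {X : Type*} [NormedAddCommGroup X] [NormedSpace ℝ X]

/-- The sequence `E₀ = E`, `Eₙ₊₁ = closure (conv (T Eₙ))`. It is decreasing if `E` is closed and
convex and `T` maps `E` into itself. -/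
def closedHullIterate (T : X → X) (E : Set X) : ℕ → Set X
  | 0 => E
  | n + 1 => closure (convexHull ℝ (T '' closedHullIterate T E n))

theorem isClosed_closedHullIterate {T : X → X} {E : Set X} (hE : IsClosed E) :
    ∀ n, IsClosed (closedHullIterate T E n)
  | 0 => hE
  | _ + 1 => isClosed_closure

theorem convex_closedHullIterate {T : X → X} {E : Set X} (hE : Convex ℝ E) :
    ∀ n, Convex ℝ (closedHullIterate T E n)
  | 0 => hE
  | _ + 1 => (convex_convexHull ℝ _).closure

theorem nonempty_closedHullIterate {T : X → X} {E : Set X} (hE : E.Nonempty) :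
    ∀ n, (closedHullIterate T E n).Nonempty
  | 0 => hE
  | n + 1 => ((nonempty_closedHullIterate hE n).image T).convexHull.closure

theorem closedHullIterate_succ_subset {T : X → X} {E : Set X} (hE : IsClosed E)
    (hEc : Convex ℝ E) (hT : Set.MapsTo T E E) :
    ∀ n, closedHullIterate T E (n + 1) ⊆ closedHullIterate T E n
  | 0 => closure_minimal (convexHull_min hT.image_subset hEc) hE
  | n + 1 => closure_mono (convexHull_mono
      (Set.image_mono (closedHullIterate_succ_subset hE hEc hT n)))

theorem mapsTo_closedHullIterate (T : X → X) (E : Set X) (n : ℕ) :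
    Set.MapsTo T (closedHullIterate T E n) (closedHullIterate T E (n + 1)) := fun _ hx =>
  subset_closure (subset_convexHull ℝ _ (Set.mem_image_of_mem T hx))

end Darbo

theorem corollary3p7 {X : Type*} [NormedAddCommGroup X] [NormedSpace ℝ X] [CompleteSpace X]
    (μ : Set X → ℝ) (hμ : IsMeasureOfNoncompactness μ)
    (E : Set X) (hE_nonempty : E.Nonempty) (hE_bounded : Bornology.IsBounded E)
    (hE_closed : IsClosed E) (hE_convex : Convex ℝ E)
    (T : X → X) (hT_maps : Set.MapsTo T E E) (hT_cont : ContinuousOn T E)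
    (k : ℝ) (hk : k ∈ Set.Ico (0 : ℝ) 1)
    (hT : ∀ A : Set X, A ⊆ E → A.Nonempty → μ (T '' A) ≤ k * μ A) :
    ∃ x ∈ E, T x = x := by
  have hanti := closedHullIterate_succ_subset hE_closed hE_convex hT_maps
  have hsub : ∀ n, closedHullIterate T E n ⊆ E := fun n =>
    antitone_nat_of_succ_le hanti (Nat.zero_le n)
  have hmem : ∀ n, closedHullIterate T E n ∈ nonemptyBounded X := fun n =>
    ⟨nonempty_closedHullIterate hE_nonempty n, hE_bounded.subset (hsub n)⟩
  have hle : ∀ n, μ (closedHullIterate T E n) ≤ k ^ n * μ E := by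
    intro n
    induction n with
    | zero => simp [closedHullIterate]
    | succ n ih =>
      have hne := (nonempty_closedHullIterate (T := T) hE_nonempty n).image T
      have hb : Bornology.IsBounded (T '' closedHullIterate T E n) :=
        hE_bounded.subset ((Set.image_mono (hsub n)).trans hT_maps.image_subset)
      have heq : μ (closedHullIterate T E (n + 1)) = μ (T '' closedHullIterate T E n) := by
        rw [closedHullIterate, hμ.closure_eq _ ⟨hne.convexHull, isBounded_convexHull.2 hb⟩,
          hμ.convexHull_eq _ ⟨hne, hb⟩]
      calc μ (closedHullIterate T E (n + 1)) ≤ k * μ (closedHullIterate T E n) :=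
            heq.trans_le (hT _ (hsub n) (hmem n).1)
        _ ≤ k * (k ^ n * μ E) := mul_le_mul_of_nonneg_left ih hk.1
        _ = k ^ (n + 1) * μ E := by ring
  have hlim : Tendsto (fun n => μ (closedHullIterate T E n)) atTop (𝓝 0) := by
    refine squeeze_zero (fun n => hμ.nonneg _ (hmem n)) hle ?_
    simpa using (tendsto_pow_atTop_nhds_zero_of_lt_one hk.1 hk.2).mul_const (μ E)
  set K : Set X := ⋂ n, closedHullIterate T E n with hKdef
  have hKne : K.Nonempty :=
    hμ.iInter_nonempty _ hmem (isClosed_closedHullIterate hE_closed) hanti hlim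
  have hKsub : ∀ n, K ⊆ closedHullIterate T E n := Set.iInter_subset _
  have hKmem : K ∈ nonemptyBounded X := ⟨hKne, hE_bounded.subset (hKsub 0)⟩
  have hK0 : μ K = 0 := le_antisymm
    (ge_of_tendsto' hlim fun n => hμ.mono _ hKmem _ (hmem n) (hKsub n)) (hμ.nonneg _ hKmem)
  have hKcompact : IsCompact K := by
    have := hμ.isCompact_closure_of_eq_zero _ hKmem hK0
    rwa [(isClosed_iInter (isClosed_closedHullIterate hE_closed)).closure_eq] at this
  have hKmaps : Set.MapsTo T K K := fun x hx => Set.mem_iInter.2 fun n =>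
    hanti n (mapsTo_closedHullIterate T E n (hKsub n hx))
  obtain ⟨x, hx, hfix⟩ := exists_fixedPoint_of_mapsTo_isCompact hKcompact
    (convex_iInter (convex_closedHullIterate hE_convex)) hKne
    (hT_cont.mono (hKsub 0)) hKmaps
  exact ⟨x, hKsub 0 hx, hfix⟩
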